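/- Let $1\le k<n$ be integers, $s\in(1/2,1)$, and write $x=(y,z)\in\mathbb R^k\times\mathbb R^{n-k}=\mathbb R^n$. Let $\mathcal K_k^s$ be the set of nonnegative functions $K$ on $\mathbb R^n$, Lebesgue measurable on $\mathbb R^n$ and on each slice $\mathbb R^k\times\{z\}$, such that for all $z\in\mathbb R^{n-k}$ and all $r>0$ $$\mathcal H^k\big(\{y\in\mathbb R^k: K(y,z)>r^{-n-2s}\}\big)=\begin{cases}\mathcal H^k\big(B_{(r^2-|z|^2)^{1/2}}\big)&\text{if }|z|<r,\\ 0&\text{if }|z|\ge r,\end{cases}$$ where $B_\rho$ is the ball of radius $\rho$ in $\mathbb R^k$ and $\mathcal H^k$ is $k$-dimensional (Lebesgue) measure. Let $x_0\in\mathbb R^n$ and let $u:\mathbb R^n\to\mathbb R$ be continuous and $C^{1,1}$ at $x_0$, i.e. there are $p\in\mathbb R^n$ and $\rho,C>0$ with $|u(x_0+x)-u(x_0)-x\cdot p|\le C|x|^2$ for $|x|<\rho$. Assume that $\int_{\mathbb R^n}|u(x)|(1+|x|)^{-n-2s}\,dx<\infty$ and that $$\tilde u(x):=u(x_0+x)-u(x_0)-x\cdot\nabla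 u(x_0)\ge 0\quad\text{for all }x\in\mathbb R^n.$$ Put $$\mathcal F_k^su(x_0)=c_{n,s}\inf_{K\in\mathcal K_k^s}\int_{\mathbb R^n}\tilde u(x)K(x)\,dx,\qquad c_{n,s}=\frac{4^s\,\Gamma(n/2+s)}{\pi^{n/2}\,|\Gamma(-s)|}.$$ Suppose that there is $\lambda_0>0$ such that for all $z\in\mathbb R^{n-k}$ $$\mathcal H^k\big(\{y\in\mathbb R^k:\tilde u(y,z)\le\lambda\}\big)\begin{cases}<\infty&\text{for }0<\lambda<\lambda_0,\\=\infty&\text{for }\lambda\ge\lambda_0.\end{cases}$$ Then there is a kernel $K_0\in\mathcal K_k^s$ with $\operatorname{supp}K_0(\cdot,z)\subseteq\{y\in\mathbb R^k:\tilde u(y,z)\le\lambda_0\}$ for every $z\in\mathbb R^{n-k}$, such that $\tilde uK_0$ is integrable on $\mathbb R^n$ and $$\mathcal F_k^su(x_0)=c_{n,s}\int_{\mathbb R^{n-k}}\int_{\mathbb R^k}\tilde u(y,z)K_0(y,z)\,dy\,dz.$$ In particular, the infimum is finite and is attained at $K_0$. -/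

import Mathlib

open MeasureTheory Metric Set
open scoped ENNReal Gradient

namespace NonlocalMA

/-- `ℝⁿ` with its Euclidean norm. -/
abbrev E (n : ℕ) : Type := EuclideanSpace ℝ (Fin n)

/-- The point `x = (y, z)` of `ℝⁿ = ℝᵏ × ℝⁿ⁻ᵏ`, where `n = k + m`: its first `k` coordinates
are those of `y` and its last `m = n - k` coordinates are those of `z`. -/
def join {k m : ℕ} (y : E k) (z : E m) : E (k + m) :=
  WithLp.toLp 2 (Fin.append y.ofLp z.ofLp)

/-- The constant `c_{n,s} = 4ˢ Γ(n/2 + s) / (π^{n/2} |Γ(-s)|)` of the fractional Laplacian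
`Δˢ u(x₀) = c_{n,s} PV ∫ (u(x₀ + x) - u(x₀)) |x|^{-n-2s} dx`. -/
noncomputable def fracConst (n : ℕ) (s : ℝ) : ℝ :=
  (4 : ℝ) ^ s * Real.Gamma ((n : ℝ) / 2 + s) /
    (Real.pi ^ ((n : ℝ) / 2) * |Real.Gamma (-s)|)

/-- The class `𝒦ₖˢ` of admissible kernels on `ℝⁿ`, `n = k + m`: nonnegative functions, Lebesgue
measurable on `ℝⁿ` and on every slice `ℝᵏ × {z}`, such that for all `z` and all `r > 0` the
`k`-dimensional measure of `{y : K(y,z) > r^{-n-2s}}` is that of the ball of radius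
`(r² - |z|²)^{1/2}` of `ℝᵏ` if `|z| < r`, and `0` if `|z| ≥ r`.
(The `k`-dimensional Hausdorff measure on `ℝᵏ`, normalized as usual so that the unit ball has
measure `π^{k/2} / Γ(k/2 + 1)`, is Lebesgue measure.) -/
def kernels (k m : ℕ) (s : ℝ) : Set (E (k + m) → ℝ) :=
  {K | (∀ x, 0 ≤ K x) ∧ AEMeasurable K volume ∧
    (∀ z : E m, AEMeasurable (fun y : E k => K (join y z)) volume) ∧
    ∀ (z : E m) (r : ℝ), 0 < r →
      volume {y : E k | r ^ (-((k + m : ℕ) : ℝ) - 2 * s) < K (join y z)} =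
        if ‖z‖ < r then volume (ball (0 : E k) (Real.sqrt (r ^ 2 - ‖z‖ ^ 2))) else 0}

/-- `ũ(x) = u(x₀ + x) - u(x₀) - x · ∇u(x₀)`. -/
noncomputable def tilde {n : ℕ} (u : E n → ℝ) (x₀ x : E n) : ℝ :=
  u (x₀ + x) - u x₀ - inner ℝ x (∇ u x₀)

/-- `u ∈ C^{1,1}(x₀)`. -/
def C11At {n : ℕ} (u : E n → ℝ) (x₀ : E n) : Prop :=
  ∃ (p : E n) (ρ C : ℝ), 0 < ρ ∧ 0 < C ∧
    ∀ x ∈ ball (0 : E n) ρ, |u (x₀ + x) - u x₀ - inner ℝ x p| ≤ C * ‖x‖ ^ 2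

/-- The integral of `f` over `ℝⁿ` with values in `[-∞, ∞]`: `∫ f⁺ - ∫ f⁻`. -/
noncomputable def extIntegral {n : ℕ} (f : E n → ℝ) : EReal :=
  ((∫⁻ x, ENNReal.ofReal (f x) : ℝ≥0∞) : EReal) - ((∫⁻ x, ENNReal.ofReal (-f x) : ℝ≥0∞) : EReal)

/-- The operator `𝓕ₖˢ u(x₀) = c_{n,s} inf_{K ∈ 𝒦ₖˢ} ∫_{ℝⁿ} ũ(x) K(x) dx`, `n = k + m`. -/
noncomputable def nonlocalOp (k m : ℕ) (s : ℝ) (u : E (k + m) → ℝ) (x₀ : E (k + m)) : EReal :=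
  (fracConst (k + m) s : EReal) * ⨅ K ∈ kernels k m s, extIntegral (fun x => tilde u x₀ x * K x)

end NonlocalMA

namespace NonlocalMA

section Coordinates

variable {k m : ℕ}

/-- The splitting `ℝᵏ × ℝᵐ ≃ ℝᵏ⁺ᵐ` as a linear isometry. -/
noncomputable def joinIsometry (k m : ℕ) : WithLp 2 (E k × E m) ≃ₗᵢ[ℝ] E (k + m) :=
  ((LinearIsometryEquiv.piLpCongrLeft 2 ℝ ℝ finSumFinEquiv.symm).trans
    (PiLp.sumPiLpEquivProdLpPiLp 2 _)).symm

lemma joinIsometry_toLp (y : E k) (z : E m) :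
    joinIsometry k m (WithLp.toLp 2 (y, z)) = join y z := by
  rw [joinIsometry, LinearIsometryEquiv.symm_apply_eq]
  refine (WithLp.equiv 2 _).injective (Prod.ext ?_ ?_) <;> ext i <;>
    simp [join, LinearIsometryEquiv.piLpCongrLeft]

lemma norm_join (y : E k) (z : E m) : ‖join y z‖ = √(‖y‖ ^ 2 + ‖z‖ ^ 2) := by
  rw [← joinIsometry_toLp, LinearIsometryEquiv.norm_map]
  exact WithLp.prod_norm_eq_of_L2 _

/-- The splitting `ℝᵏ × ℝᵐ ≃ ℝᵏ⁺ᵐ` as a measurable equivalence. -/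
noncomputable def joinEquiv (k m : ℕ) : E k × E m ≃ᵐ E (k + m) :=
  (MeasurableEquiv.toLp 2 (E k × E m)).trans (joinIsometry k m).toMeasurableEquiv

lemma joinEquiv_apply (p : E k × E m) : joinEquiv k m p = join p.1 p.2 :=
  joinIsometry_toLp p.1 p.2

lemma measurePreserving_joinEquiv : MeasurePreserving (joinEquiv k m) :=
  (WithLp.volume_preserving_toLp _ _).trans (joinIsometry k m).measurePreserving

lemma continuous_join : Continuous fun p : E k × E m => join p.1 p.2 := by
  simp only [← joinIsometry_toLp]
  exact (joinIsometry k m).continuous.comp (WithLp.prod_continuous_toLp 2 _ _)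

lemma lintegral_join {f : E (k + m) → ℝ≥0∞} (hf : AEMeasurable f) :
    ∫⁻ x, f x = ∫⁻ z : E m, ∫⁻ y : E k, f (join y z) := by
  rw [← (measurePreserving_joinEquiv (k := k) (m := m)).lintegral_comp_emb
    (joinEquiv k m).measurableEmbedding, Measure.volume_eq_prod, lintegral_prod_symm]
  · simp only [joinEquiv_apply]
  · exact hf.comp_quasiMeasurePreserving measurePreserving_joinEquiv.quasiMeasurePreserving

lemma integral_join {f : E (k + m) → ℝ} (hf : Integrable f) :
    ∫ x, f x = ∫ z : E m, ∫ y : E k, f (join y z) := by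
  rw [← (measurePreserving_joinEquiv (k := k) (m := m)).integral_comp
    (joinEquiv k m).measurableEmbedding, Measure.volume_eq_prod, integral_prod_symm]
  · simp only [joinEquiv_apply]
  · exact (measurePreserving_joinEquiv.integrable_comp_emb
      (joinEquiv k m).measurableEmbedding).2 hf

end Coordinates

section Rearrangement

/-- If the sublevel sets of `φ` below the level `c₀` have finite measure, then every value `v`
between the measure of some `{φ < b}` and that of `{φ ≤ c₀}` lies between the measures of
`{φ < c}` and `{φ ≤ c}` for some `c ≤ c₀`. -/
lemma exists_level {α : Type*} [MeasurableSpace α] {μ : Measure α} {φ : α → ℝ}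
    (hφ : Measurable φ) {v : ℝ≥0∞} {b c₀ : ℝ} (hbc : b ≤ c₀) (hb : μ {x | φ x < b} ≤ v)
    (hc₀ : v ≤ μ {x | φ x ≤ c₀}) (hfin : ∀ c, b ≤ c → c < c₀ → ∃ d > c, μ {x | φ x < d} ≠ ∞) :
    ∃ c ≤ c₀, μ {x | φ x < c} ≤ v ∧ v ≤ μ {x | φ x ≤ c} := by
  set T : Set ℝ := {c | c ≤ c₀ ∧ μ {x | φ x < c} ≤ v} with hT
  have hbT : b ∈ T := ⟨hbc, hb⟩
  have hbdd : BddAbove T := ⟨c₀, fun c hc => hc.1⟩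
  have hle : sSup T ≤ c₀ := csSup_le ⟨b, hbT⟩ fun c hc => hc.1
  refine ⟨sSup T, hle, ?_, ?_⟩
  · obtain ⟨w, hw, hwlt, hwlim⟩ := exists_seq_strictMono_tendsto (sSup T)
    have hU : {x | φ x < sSup T} = ⋃ i, {x | φ x < w i} := by
      ext x
      simp only [mem_ofPred_eq, mem_iUnion]
      constructor
      · exact fun hx => (hwlim.eventually (lt_mem_nhds hx)).exists
      · rintro ⟨i, hi⟩
        exact hi.trans (hwlt i)
    have hmono : Monotone fun i => {x | φ x < w i} :=
      fun i j hij x (hx : φ x < w i) => hx.trans_le (hw.monotone hij)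
    rw [hU, hmono.measure_iUnion]
    refine iSup_le fun i => ?_
    obtain ⟨c, hc, hwc⟩ := exists_lt_of_lt_csSup ⟨b, hbT⟩ (hwlt i)
    exact (measure_mono fun x (hx : φ x < w i) => hx.trans hwc).trans hc.2
  · rcases hle.eq_or_lt with h | h
    · rwa [h]
    obtain ⟨d, hd, hdfin⟩ := hfin _ (le_csSup hbdd hbT) h
    obtain ⟨w, hw, hwlt, hwlim⟩ := exists_seq_strictAnti_tendsto' (lt_min h hd)
    have hI : {x | φ x ≤ sSup T} = ⋂ i, {x | φ x < w i} := by
      ext x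
      simp only [mem_ofPred_eq, mem_iInter]
      constructor
      · exact fun hx i => hx.trans_lt (hwlt i).1
      · exact fun hx => ge_of_tendsto' hwlim fun i => (hx i).le
    have hanti : Antitone fun i => {x | φ x < w i} :=
      fun i j hij x (hx : φ x < w j) => hx.trans_le (hw.antitone hij)
    rw [hI, hanti.measure_iInter (fun i => (measurableSet_lt hφ measurable_const).nullMeasurableSet)
      ⟨0, ((measure_mono fun x (hx : φ x < w 0) =>
        hx.trans ((hwlt 0).2.trans_le (min_le_right _ _))).trans_lt hdfin.lt_top).ne⟩]
    refine le_iInf fun i => ?_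
    by_contra! hlt
    exact (hwlt i).1.not_ge
      (le_csSup hbdd ⟨((hwlt i).2.trans_le (min_le_left _ _)).le, hlt.le⟩)

variable {X : Type*} [NormedAddCommGroup X]

/-- The strict order of points by the value of `f`, ties being broken by the norm. -/
def Precedes (f : X → ℝ) (x y : X) : Prop :=
  f x < f y ∨ f x = f y ∧ ‖x‖ < ‖y‖

lemma Precedes.le {f : X → ℝ} {x y : X} (h : Precedes f x y) : f x ≤ f y :=
  h.elim le_of_lt fun h => h.1.le

lemma Precedes.asymm {f : X → ℝ} {x y : X} (h : Precedes f x y) : ¬ Precedes f y x := by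
  rcases h with h | ⟨h, h'⟩ <;> rintro (g | ⟨g, g'⟩) <;> linarith

/-- A set all of whose points precede all the points outside. -/
def IsInitial (f : X → ℝ) (A : Set X) : Prop :=
  ∀ x ∈ A, ∀ y ∉ A, Precedes f x y

variable [MeasurableSpace X]

/-- The measure of the set of the points that precede `y`. -/
noncomputable def rank (μ : Measure X) (f : X → ℝ) (y : X) : ℝ≥0∞ :=
  μ {x | Precedes f x y}

lemma measurableSet_precedes [BorelSpace X] [SecondCountableTopology X] {Z : Type*}
    [MeasurableSpace Z] {g : X × Z → ℝ} (hg : Measurable g) :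
    MeasurableSet {q : (X × Z) × X | Precedes (fun x => g (x, q.1.2)) q.2 q.1.1} := by
  have h₁ : Measurable fun q : (X × Z) × X => g (q.2, q.1.2) := by fun_prop
  have h₂ : Measurable fun q : (X × Z) × X => g (q.1.1, q.1.2) := by fun_prop
  have h₃ : Measurable fun q : (X × Z) × X => ‖q.2‖ := by fun_prop
  have h₄ : Measurable fun q : (X × Z) × X => ‖q.1.1‖ := by fun_prop
  exact (measurableSet_lt h₁ h₂).union ((measurableSet_eq_fun h₁ h₂).inter (measurableSet_lt h₃ h₄))

lemma measurable_rank [BorelSpace X] [SecondCountableTopology X] {Z : Type*}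
    [MeasurableSpace Z] {g : X × Z → ℝ} (hg : Measurable g) (μ : Measure X) [SFinite μ] :
    Measurable fun p : X × Z => rank μ (fun x => g (x, p.2)) p.1 :=
  measurable_measure_prodMk_left (measurableSet_precedes hg)

lemma le_of_rank_ne_top {μ : Measure X} {f : X → ℝ} {c : ℝ} (hc : μ {x | f x ≤ c} = ∞) {y : X}
    (hy : rank μ f y ≠ ∞) : f y ≤ c := by
  by_contra! h
  refine hy (top_le_iff.1 (hc.symm.le.trans (measure_mono fun x (hx : f x ≤ c) => ?_)))
  exact Or.inl (hx.trans_lt h)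

lemma IsInitial.rank_le {μ : Measure X} {f : X → ℝ} {A : Set X} (hA : IsInitial f A) {y : X}
    (hy : y ∈ A) : rank μ f y ≤ μ A :=
  measure_mono fun x hx => by
    by_contra h
    exact (hA y hy x h).asymm hx

lemma IsInitial.le_rank {μ : Measure X} {f : X → ℝ} {A : Set X} (hA : IsInitial f A) {y : X}
    (hy : y ∉ A) : μ A ≤ rank μ f y :=
  measure_mono fun x hx => hA x hx y hy

/-- Among the sets of a given finite measure, initial sets minimize the integral of `f`. -/
lemma IsInitial.setLIntegral_le {μ : Measure X} {f : X → ℝ} {A B : Set X} (hA : IsInitial f A)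
    (hAm : NullMeasurableSet A μ) (hBm : NullMeasurableSet B μ) (hAB : μ A = μ B)
    (hB : μ B ≠ ∞) :
    ∫⁻ x in A, ENNReal.ofReal (f x) ∂μ ≤ ∫⁻ x in B, ENNReal.ofReal (f x) ∂μ := by
  have hdiff : μ (A \ B) = μ (B \ A) := by
    have h₁ := measure_inter_add_sdiff₀ A hBm
    have h₂ := measure_inter_add_sdiff₀ B hAm
    rw [hAB, ← h₂, inter_comm B A] at h₁
    exact (ENNReal.add_right_inj ((measure_mono inter_subset_right).trans_lt hB.lt_top).ne).1 h₁
  rw [← Measure.restrict_inter_add_sdiff₀ A hBm, ← Measure.restrict_inter_add_sdiff₀ B hAm,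
    inter_comm B A, lintegral_add_measure, lintegral_add_measure]
  refine add_le_add le_rfl ?_
  set c : ℝ≥0∞ := ⨆ x ∈ A \ B, ENNReal.ofReal (f x)
  calc ∫⁻ x in A \ B, ENNReal.ofReal (f x) ∂μ
      ≤ ∫⁻ _ in A \ B, c ∂μ := by
        refine lintegral_mono_ae ?_
        filter_upwards [ae_restrict_mem₀ (hAm.diff hBm)] with x hx
        exact le_iSup₂ (f := fun x _ => ENNReal.ofReal (f x)) x hx
    _ = ∫⁻ _ in B \ A, c ∂μ := by simp [hdiff]
    _ ≤ ∫⁻ x in B \ A, ENNReal.ofReal (f x) ∂μ := by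
        refine lintegral_mono_ae ?_
        filter_upwards [ae_restrict_mem₀ (hBm.diff hAm)] with y hy
        exact iSup₂_le fun x hx => ENNReal.ofReal_le_ofReal (hA x hx.1 y hy.2).le

variable [BorelSpace X] [NormedSpace ℝ X] [FiniteDimensional ℝ X] [Nontrivial X]
  (μ : Measure X) [μ.IsAddHaarMeasure] {f : X → ℝ} {c₀ : ℝ}

/-- A set of measure larger than `w` meets some centred ball in a set of measure `w`. -/
lemma exists_inter_ball_measure_eq {S : Set X} {w : ℝ≥0∞} (hw : w < μ S) :
    ∃ ρ, μ (S ∩ {x | ‖x‖ < ρ}) = w := by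
  have hU : S = ⋃ N : ℕ, S ∩ {x | ‖x‖ ≤ N} := by
    rw [← inter_iUnion, eq_comm, inter_eq_left]
    intro x _
    simpa using exists_nat_ge ‖x‖
  have hmono : Monotone fun N : ℕ => S ∩ {x : X | ‖x‖ ≤ N} := by
    intro i j hij x hx
    exact ⟨hx.1, le_trans (b := (i : ℝ)) hx.2 (by exact_mod_cast hij)⟩
  rw [hU, hmono.measure_iUnion] at hw
  obtain ⟨N, hN⟩ := lt_iSup_iff.1 hw
  have hr : ∀ T : Set X, MeasurableSet T → μ (S ∩ T) = μ.restrict S T := fun T hT => by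
    rw [Measure.restrict_apply hT, inter_comm]
  have hm₁ : ∀ c : ℝ, MeasurableSet {x : X | ‖x‖ < c} :=
    fun c => measurableSet_lt measurable_norm measurable_const
  have hm₂ : ∀ c : ℝ, MeasurableSet {x : X | ‖x‖ ≤ c} :=
    fun c => measurableSet_le measurable_norm measurable_const
  obtain ⟨c, -, hc₁, hc₂⟩ := exists_level (μ := μ.restrict S) (φ := fun x : X => ‖x‖) (v := w)
    (b := 0) (c₀ := N) measurable_norm N.cast_nonneg
    (by simp [show {x : X | ‖x‖ < 0} = ∅ from eq_empty_of_forall_notMem fun x hx =>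
      (norm_nonneg x).not_gt hx]) (by rw [← hr _ (hm₂ _)]; exact hN.le)
    (fun c _ _ => ⟨c + 1, by simp, by
      rw [← hr _ (hm₁ _)]
      refine ((measure_mono inter_subset_right).trans_lt ?_).ne
      have : {x : X | ‖x‖ < c + 1} = ball 0 (c + 1) := by ext; simp
      rw [this]
      exact measure_ball_lt_top⟩)
  refine ⟨c, le_antisymm ((hr _ (hm₁ c)).trans_le hc₁) ?_⟩
  rw [← hr _ (hm₂ c)] at hc₂
  refine hc₂.trans ?_
  calc μ (S ∩ {x | ‖x‖ ≤ c}) ≤ μ (S ∩ {x | ‖x‖ < c} ∪ sphere 0 c) := by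
        refine measure_mono fun x hx => ?_
        rcases lt_or_eq_of_le (show ‖x‖ ≤ c from hx.2) with h | h
        · exact Or.inl ⟨hx.1, h⟩
        · exact Or.inr (by simpa using h)
    _ ≤ μ (S ∩ {x | ‖x‖ < c}) + μ (sphere 0 c) := measure_union_le _ _
    _ = μ (S ∩ {x | ‖x‖ < c}) := by rw [Measure.addHaar_sphere, add_zero]

/-- There are initial sets of every measure. -/
lemma exists_isInitial (hf : Measurable f) (hf0 : ∀ x, 0 ≤ f x) (hc₀ : 0 < c₀)
    (hfin : ∀ c, 0 < c → c < c₀ → μ {x | f x ≤ c} < ∞) (hinf : μ {x | f x ≤ c₀} = ∞)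
    (v : ℝ≥0∞) : ∃ A, IsInitial f A ∧ MeasurableSet A ∧ μ A = v := by
  obtain ⟨c, -, hc₁, hc₂⟩ := exists_level (μ := μ) hf (v := v) (b := 0) hc₀.le
    (by simp [show {x : X | f x < 0} = ∅ from eq_empty_of_forall_notMem fun x hx =>
      (hf0 x).not_gt hx]) (by simp [hinf])
    (fun c hc hcc => by
      obtain ⟨d, hd, hdc⟩ := exists_between hcc
      exact ⟨d, hd, ((measure_mono fun x (hx : f x < d) => hx.le).trans_lt
        (hfin d (hc.trans_lt hd) hdc)).ne⟩)
  have hm₁ : MeasurableSet {x | f x < c} := measurableSet_lt hf measurable_const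
  have hm₂ : MeasurableSet {x | f x = c} := measurableSet_eq_fun hf measurable_const
  rcases hc₂.eq_or_lt with h | h
  · refine ⟨{x | f x ≤ c}, fun x hx y hy => Or.inl ?_, measurableSet_le hf measurable_const, h.symm⟩
    exact lt_of_le_of_lt hx (not_le.1 hy)
  have hsplit : {x | f x ≤ c} = {x | f x < c} ∪ {x | f x = c} := by
    ext x
    simp [le_iff_lt_or_eq]
  have hdisj : Disjoint {x | f x < c} {x | f x = c} :=
    disjoint_left.2 fun x (hx : f x < c) (hx' : f x = c) => hx.ne hx'
  have hlt : v - μ {x | f x < c} < μ {x | f x = c} := by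
    rw [hsplit, measure_union hdisj hm₂] at h
    have hv : v ≠ ∞ := h.ne_top
    exact (ENNReal.sub_lt_iff_lt_right (hc₁.trans_lt hv.lt_top).ne hc₁).2 (by rwa [add_comm])
  obtain ⟨ρ, hρ⟩ := exists_inter_ball_measure_eq μ hlt
  refine ⟨{x | f x < c} ∪ ({x | f x = c} ∩ {x | ‖x‖ < ρ}), ?_, hm₁.union (hm₂.inter
    (measurableSet_lt measurable_norm measurable_const)), ?_⟩
  · intro x hx y hy
    simp only [mem_union, mem_inter_iff, mem_ofPred_eq, not_or, not_and, not_lt] at hx hy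
    rcases hx with hx | ⟨hx, hx'⟩
    · exact Or.inl (hx.trans_le hy.1)
    · rcases hy.1.eq_or_lt with h' | h'
      · exact Or.inr ⟨hx.trans h', hx'.trans_le (hy.2 h'.symm)⟩
      · exact Or.inl (hx.trans_lt h')
  · rw [measure_union (hdisj.mono_right inter_subset_left) (hm₂.inter
      (measurableSet_lt measurable_norm measurable_const)), hρ, add_tsub_cancel_of_le hc₁]

/-- The rank is equidistributed, and its sublevel sets are initial up to null sets. -/
lemma exists_isInitial_rank_lt_ae_eq (hf : Measurable f) (hf0 : ∀ x, 0 ≤ f x) (hc₀ : 0 < c₀)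
    (hfin : ∀ c, 0 < c → c < c₀ → μ {x | f x ≤ c} < ∞) (hinf : μ {x | f x ≤ c₀} = ∞)
    {v : ℝ≥0∞} (hv : v ≠ ∞) :
    ∃ A, IsInitial f A ∧ MeasurableSet A ∧ μ A = v ∧ {y | rank μ f y < v} =ᵐ[μ] A := by
  obtain ⟨A, hA, hAm, rfl⟩ := exists_isInitial μ hf hf0 hc₀ hfin hinf v
  refine ⟨A, hA, hAm, rfl, ?_⟩
  have hsub : {y | rank μ f y < μ A} ⊆ A := fun y hy => by
    by_contra h
    exact (hA.le_rank h).not_gt hy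
  have hrm : Measurable (rank μ f) :=
    (measurable_rank (Z := Unit) (g := fun p => f p.1) (by fun_prop) μ).comp
      (measurable_id.prodMk (measurable_const (a := ())))
  refine ae_eq_of_subset_of_measure_ge hsub ?_
    (measurableSet_lt hrm measurable_const).nullMeasurableSet hv
  refine le_of_forall_lt fun w hw => ?_
  obtain ⟨w', hw, hw'⟩ := exists_between hw
  obtain ⟨B, hB, -, hBw⟩ := exists_isInitial μ hf hf0 hc₀ hfin hinf w'
  refine hw.trans_le (hBw.symm.le.trans (measure_mono fun y hy => ?_))
  exact ((hB.rank_le hy).trans hBw.le).trans_lt hw'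

end Rearrangement

/-- The layer cake formula with a density. -/
lemma lintegral_mul_eq_lintegral_setLIntegral {X : Type*} [MeasurableSpace X] {μ : Measure X}
    [SFinite μ] {f g : X → ℝ} (hf : Measurable f) (hf0 : ∀ x, 0 ≤ f x) (hg : AEMeasurable g μ)
    (hg0 : ∀ x, 0 ≤ g x) :
    ∫⁻ x, ENNReal.ofReal (f x * g x) ∂μ =
      ∫⁻ t in Ioi (0 : ℝ), ∫⁻ x in {x | t < g x}, ENNReal.ofReal (f x) ∂μ := by
  have h := lintegral_eq_lintegral_meas_lt (μ.withDensity fun x => ENNReal.ofReal (f x))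
    (.of_forall hg0) (hg.mono_ac (withDensity_absolutelyContinuous _ _))
  rw [lintegral_withDensity_eq_lintegral_mul_non_measurable _ (by fun_prop) (by simp)] at h
  simp only [withDensity_apply', Pi.mul_apply, ← ENNReal.ofReal_mul (hf0 _)] at h
  exact h

section Integrability

variable {n : ℕ}

lemma C11At.exists_gradient {u : E n → ℝ} {x₀ : E n} (h : C11At u x₀) :
    ∃ ρ C : ℝ, 0 < ρ ∧ 0 < C ∧ ∀ x ∈ ball (0 : E n) ρ, |tilde u x₀ x| ≤ C * ‖x‖ ^ 2 := by
  obtain ⟨p, ρ, C, hρ, hC, hb⟩ := h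
  have hg : HasGradientAt u p x₀ := by
    rw [hasGradientAt_iff_isLittleO_nhds_zero]
    have hO : (fun x : E n => u (x₀ + x) - u x₀ - inner ℝ p x) =O[nhds 0]
        fun x => ‖x‖ ^ 2 := by
      refine Asymptotics.IsBigO.of_bound C ?_
      filter_upwards [ball_mem_nhds (0 : E n) hρ] with x hx
      rw [real_inner_comm, Real.norm_eq_abs, norm_pow, norm_norm]
      exact hb x hx
    exact hO.trans_isLittleO (Asymptotics.isLittleO_norm_pow_id one_lt_two)
  refine ⟨ρ, C, hρ, hC, fun x hx => ?_⟩
  rw [tilde, hg.gradient]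
  exact hb x hx

lemma integrableOn_ball_norm_rpow (hn : 1 ≤ n) {b : ℝ} (hb : -(n : ℝ) < b) (ρ : ℝ) :
    IntegrableOn (fun x : E n => ‖x‖ ^ b) (ball 0 ρ) := by
  have : NeZero n := ⟨by omega⟩
  have : Nonempty (Fin n) := ⟨0⟩
  refine (integrableOn_fun_norm_addHaar volume (f := fun t : ℝ => t ^ b)).2 ?_
  rcases le_or_gt ρ 0 with hρ | hρ
  · simp [Ioo_eq_empty_of_le hρ]
  have h : IntegrableOn (fun t : ℝ => t ^ ((n : ℝ) - 1 + b)) (Ioo 0 ρ) :=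
    (intervalIntegral.integrableOn_Ioo_rpow_iff hρ).2 (by linarith)
  refine h.congr_fun (fun t ht => ?_) measurableSet_Ioo
  simp only [finrank_euclideanSpace, Fintype.card_fin, smul_eq_mul]
  rw [Real.rpow_add ht.1, ← Real.rpow_natCast, Nat.cast_sub hn, Nat.cast_one]

lemma norm_rpow_neg_le_of_one_add_le {x : E n} {w M a ρ : ℝ} (hρ : 0 < ρ) (hx : ρ ≤ ‖x‖)
    (hw : 0 < w) (hM : 0 < M) (h : w ≤ M * ‖x‖) (ha : 0 < a) : ‖x‖ ^ (-a) ≤ M ^ a * w ^ (-a) := by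
  have hx0 : 0 < ‖x‖ := hρ.trans_le hx
  rw [Real.rpow_neg hx0.le, Real.rpow_neg hw.le, ← div_eq_mul_inv, ← Real.div_rpow hM.le hw.le,
    ← Real.inv_rpow hx0.le]
  refine Real.rpow_le_rpow (by positivity) ?_ ha.le
  rw [le_div_iff₀ hw, inv_mul_le_iff₀ hx0, mul_comm]
  exact h

/-- The integral of `ũ` against the kernel of the fractional Laplacian converges. -/
lemma integrable_tilde_mul_norm_rpow (hn : 1 ≤ n) {s : ℝ} (hs : 1 / 2 < s) (hs' : s < 1)
    {u : E n → ℝ} {x₀ : E n} (hcont : Continuous u) (hC11 : C11At u x₀)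
    (hint : Integrable fun x => |u x| / (1 + ‖x‖) ^ ((n : ℝ) + 2 * s)) :
    Integrable fun x => tilde u x₀ x * ‖x‖ ^ (-((n : ℝ) + 2 * s)) := by
  obtain ⟨ρ, C, hρ, hC, hb⟩ := hC11.exists_gradient
  set a : ℝ := (n : ℝ) + 2 * s with ha
  have ha0 : 0 < a := by positivity
  set p := ∇ u x₀ with hp
  set M₁ : ℝ := 1 + (1 + ‖x₀‖) / ρ with hM₁
  set M₂ : ℝ := 1 + 1 / ρ with hM₂
  have hM₁0 : 0 < M₁ := by positivity
  have hM₂0 : 0 < M₂ := by positivity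
  have h₁ : Integrable ((ball (0 : E n) ρ).indicator fun x => C * ‖x‖ ^ (2 - a)) :=
    IntegrableOn.integrable_indicator ((integrableOn_ball_norm_rpow hn
      (b := 2 - a) (by linarith) ρ).const_mul C) measurableSet_ball
  have h₂ : Integrable fun x => M₁ ^ a * (|u (x₀ + x)| / (1 + ‖x₀ + x‖) ^ a) :=
    (hint.comp_add_left x₀).const_mul _
  have h₃ : Integrable fun x : E n => (|u x₀| + ‖p‖) * M₂ ^ a * (1 + ‖x‖) ^ (-(a - 1)) :=
    (integrable_one_add_norm (by simp [ha]; linarith)).const_mul _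
  refine ((h₁.add h₂).add h₃).mono' ?_ (.of_forall fun x => ?_)
  · have : Measurable (tilde u x₀) := by
      unfold tilde
      have := hcont.measurable
      fun_prop
    exact (this.mul (by fun_prop)).aestronglyMeasurable
  have hP₂ : 0 ≤ M₁ ^ a * (|u (x₀ + x)| / (1 + ‖x₀ + x‖) ^ a) := by positivity
  have hP₃ : 0 ≤ (|u x₀| + ‖p‖) * M₂ ^ a * (1 + ‖x‖) ^ (-(a - 1)) := by positivity
  simp only [Pi.add_apply, Real.norm_eq_abs, abs_mul]
  rw [abs_of_nonneg (Real.rpow_nonneg (norm_nonneg x) _)]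
  by_cases hx : x ∈ ball (0 : E n) ρ
  · rw [indicator_of_mem hx]
    refine le_trans ?_ (le_add_of_le_of_nonneg (le_add_of_le_of_nonneg le_rfl hP₂) hP₃)
    rcases eq_or_ne x 0 with rfl | hx0
    · have : |tilde u x₀ 0| = 0 := by simp [tilde]
      rw [this, zero_mul]
      positivity
    · have hx0 : 0 < ‖x‖ := norm_pos_iff.2 hx0
      rw [sub_eq_add_neg, Real.rpow_add hx0, ← mul_assoc, Real.rpow_two]
      exact mul_le_mul_of_nonneg_right (hb x hx) (by positivity)
  · rw [indicator_of_notMem hx, zero_add]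
    have hx : ρ ≤ ‖x‖ := by simpa using hx
    have h1ρ : 1 ≤ ‖x‖ / ρ := (one_le_div hρ).2 hx
    have hk₁ : ‖x‖ ^ (-a) ≤ M₁ ^ a * (1 + ‖x₀ + x‖) ^ (-a) := by
      refine norm_rpow_neg_le_of_one_add_le hρ hx (by positivity) hM₁0 ?_ ha0
      have h := norm_add_le x₀ x
      have h' : (1 + ‖x₀‖) * 1 ≤ (1 + ‖x₀‖) * (‖x‖ / ρ) :=
        mul_le_mul_of_nonneg_left h1ρ (by positivity)
      calc 1 + ‖x₀ + x‖ ≤ ‖x‖ + (1 + ‖x₀‖) * (‖x‖ / ρ) := by linarith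
        _ = M₁ * ‖x‖ := by rw [hM₁]; ring
    have hk₂ : ‖x‖ ^ (-a) ≤ M₂ ^ a * (1 + ‖x‖) ^ (-a) := by
      refine norm_rpow_neg_le_of_one_add_le hρ hx (by positivity) hM₂0 ?_ ha0
      calc 1 + ‖x‖ ≤ ‖x‖ + ‖x‖ / ρ := by linarith
        _ = M₂ * ‖x‖ := by rw [hM₂]; ring
    have ht : |tilde u x₀ x| ≤ |u (x₀ + x)| + (|u x₀| + ‖p‖) * (1 + ‖x‖) := by
      have hi : |inner ℝ x p| ≤ ‖x‖ * ‖p‖ := abs_real_inner_le_norm x p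
      have h := (abs_sub (u (x₀ + x) - u x₀) (inner ℝ x p)).trans
        (add_le_add (abs_sub (u (x₀ + x)) (u x₀)) hi)
      refine h.trans ?_
      nlinarith [norm_nonneg p, mul_nonneg (abs_nonneg (u x₀)) (norm_nonneg x)]
    have hpow : (1 + ‖x‖) ^ (-(a - 1)) = (1 + ‖x‖) * (1 + ‖x‖) ^ (-a) := by
      rw [neg_sub, sub_eq_add_neg, Real.rpow_add (by positivity), Real.rpow_one]
    calc |tilde u x₀ x| * ‖x‖ ^ (-a)
        ≤ (|u (x₀ + x)| + (|u x₀| + ‖p‖) * (1 + ‖x‖)) * ‖x‖ ^ (-a) :=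
          mul_le_mul_of_nonneg_right ht (by positivity)
      _ = |u (x₀ + x)| * ‖x‖ ^ (-a) + (|u x₀| + ‖p‖) * (1 + ‖x‖) * ‖x‖ ^ (-a) := add_mul _ _ _
      _ ≤ |u (x₀ + x)| * (M₁ ^ a * (1 + ‖x₀ + x‖) ^ (-a)) +
          (|u x₀| + ‖p‖) * (1 + ‖x‖) * (M₂ ^ a * (1 + ‖x‖) ^ (-a)) := by gcongr
      _ = _ := by
          rw [hpow, Real.rpow_neg (by positivity) a, div_eq_mul_inv]
          ring

end Integrability

section Kernels

variable {k m : ℕ} {s : ℝ}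

lemma rpow_neg_lt_rpow_neg_iff {q r a : ℝ} (hq : 0 ≤ q) (hr : 0 < r) (ha : 0 < a) :
    r ^ (-a) < q ^ (-a) ↔ 0 < q ∧ q < r := by
  rcases hq.eq_or_lt with rfl | hq
  · simp [Real.zero_rpow (neg_ne_zero.2 ha.ne'), Real.rpow_nonneg hr.le]
  · simp [Real.rpow_lt_rpow_iff_of_neg hr hq (neg_neg_of_pos ha), hq]

/-- The value of the kernel `|(y, z)|⁻ⁿ⁻²ˢ` where `|y| = ρ`. -/
noncomputable def profile (k m : ℕ) (s ρ : ℝ) (z : E m) : ℝ :=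
  √(ρ ^ 2 + ‖z‖ ^ 2) ^ (-(((k + m : ℕ) : ℝ) + 2 * s))

lemma profile_nonneg (ρ : ℝ) (z : E m) : 0 ≤ profile k m s ρ z :=
  Real.rpow_nonneg (Real.sqrt_nonneg _) _

lemma lt_profile_iff (hk : 1 ≤ k) (hs : 0 < s) {ρ r : ℝ} (hρ : 0 ≤ ρ) (hr : 0 < r) (z : E m) :
    r ^ (-((k + m : ℕ) : ℝ) - 2 * s) < profile k m s ρ z ↔
      (ρ ≠ 0 ∨ z ≠ 0) ∧ ‖z‖ < r ∧ ρ < √(r ^ 2 - ‖z‖ ^ 2) := by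
  rw [← neg_add', profile, rpow_neg_lt_rpow_neg_iff (Real.sqrt_nonneg _) hr (by positivity)]
  have h₁ : 0 < √(ρ ^ 2 + ‖z‖ ^ 2) ↔ (ρ ≠ 0 ∨ z ≠ 0) := by
    rw [Real.sqrt_pos]
    constructor
    · contrapose!
      rintro ⟨rfl, rfl⟩
      simp
    · rintro (h | h)
      · positivity
      · have := norm_pos_iff.2 h
        positivity
  have h₂ : √(ρ ^ 2 + ‖z‖ ^ 2) < r ↔ ‖z‖ < r ∧ ρ < √(r ^ 2 - ‖z‖ ^ 2) := by
    rw [Real.sqrt_lt' hr, Real.lt_sqrt hρ, lt_sub_iff_add_lt, iff_and_self]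
    exact fun h => lt_of_pow_lt_pow_left₀ 2 hr.le (by nlinarith)
  rw [h₁, h₂]

/-- The superlevel sets of a kernel on a slice that is a decreasing function of a radius `ρ`, where
`ρ` is defined on `S`. -/
lemma setOf_lt_profile_ae_eq (hk : 1 ≤ k) (hs : 0 < s) {S : Set (E k)} {ρ : E k → ℝ}
    {K : E k → ℝ} (z : E m) (hρ0 : ∀ y, 0 ≤ ρ y) (hKS : ∀ y ∈ S, K y = profile k m s (ρ y) z)
    (hKS' : ∀ y ∉ S, K y = 0)
    (hρ : ∀ t, 0 < t → volume {y | y ∈ S ∧ ρ y < t} = volume (ball (0 : E k) t))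
    {r : ℝ} (hr : 0 < r) :
    ({y | r ^ (-((k + m : ℕ) : ℝ) - 2 * s) < K y} : Set (E k)) =ᵐ[volume]
      (if ‖z‖ < r then {y | y ∈ S ∧ ρ y < √(r ^ 2 - ‖z‖ ^ 2)} else ∅ : Set (E k)) := by
  have : NeZero k := ⟨by omega⟩
  have : Nonempty (Fin k) := ⟨0⟩
  have hnull : volume {y | y ∈ S ∧ ρ y = 0} = 0 := by
    have hlim : Filter.Tendsto (fun t => volume (ball (0 : E k) t)) (nhdsWithin 0 (Ioi 0))
        (nhds 0) := by
      have h : Filter.Tendsto (fun t : ℝ => ENNReal.ofReal (t ^ k) * volume (ball (0 : E k) 1))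
          (nhdsWithin 0 (Ioi 0)) (nhds (ENNReal.ofReal (0 ^ k) * volume (ball (0 : E k) 1))) := by
        refine ENNReal.Tendsto.mul_const ?_ (Or.inr measure_ball_lt_top.ne)
        exact ((ENNReal.continuous_ofReal.comp (continuous_pow k)).tendsto 0).mono_left
          nhdsWithin_le_nhds
      rw [zero_pow (by omega), ENNReal.ofReal_zero, zero_mul] at h
      refine h.congr' ?_
      filter_upwards [self_mem_nhdsWithin] with t ht
      rw [Measure.addHaar_ball volume _ (le_of_lt ht), finrank_euclideanSpace, Fintype.card_fin]
    refine le_antisymm (ge_of_tendsto hlim ?_) zero_le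
    filter_upwards [self_mem_nhdsWithin] with t ht
    rw [← hρ t ht]
    exact measure_mono fun y hy => ⟨hy.1, hy.2.trans_lt ht⟩
  have hae : ∀ᵐ y, y ∈ S → ρ y ≠ 0 := by
    rw [ae_iff]
    simpa using hnull
  refine Filter.eventuallyEq_set.2 ?_
  filter_upwards [hae] with y hy
  by_cases hyS : y ∈ S
  · rw [hKS y hyS, lt_profile_iff hk hs (hρ0 y) hr]
    split_ifs with h <;> simp [h, hyS, hy hyS]
  · rw [hKS' y hyS]
    refine iff_of_false (Real.rpow_pos_of_pos hr _).not_gt ?_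
    split_ifs <;> simp [hyS]

end Kernels

section Minimizer

variable {k m : ℕ} {s : ℝ}

/-- The kernel `|x|⁻ⁿ⁻²ˢ` of the fractional Laplacian is admissible. -/
lemma norm_rpow_mem_kernels (hk : 1 ≤ k) (hs : 0 < s) :
    (fun x : E (k + m) => ‖x‖ ^ (-(((k + m : ℕ) : ℝ) + 2 * s))) ∈ kernels k m s := by
  have hK : ∀ (z : E m) (y : E k), ‖join y z‖ ^ (-(((k + m : ℕ) : ℝ) + 2 * s)) =
      profile k m s ‖y‖ z := fun z y => by rw [norm_join, profile]
  refine ⟨fun x => Real.rpow_nonneg (norm_nonneg x) _, by fun_prop, fun z => ?_, fun z r hr => ?_⟩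
  · simp only [hK, profile]
    fun_prop
  · have hball : ∀ t, {y : E k | y ∈ (univ : Set (E k)) ∧ ‖y‖ < t} = ball 0 t := fun t => by
      ext y
      simp
    rw [measure_congr (setOf_lt_profile_ae_eq hk hs z (S := univ) (ρ := fun y => ‖y‖)
      (fun y => norm_nonneg y) (fun y _ => hK z y) (by simp) (fun t _ => by rw [hball]) hr),
      hball]
    split_ifs <;> simp

/-- The radius of the ball of `ℝᵏ` of measure `v`. -/
noncomputable def ballRadius (k : ℕ) (v : ℝ≥0∞) : ℝ :=
  (v / volume (ball (0 : E k) 1)).toReal ^ (k : ℝ)⁻¹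

lemma ballRadius_nonneg (v : ℝ≥0∞) : 0 ≤ ballRadius k v :=
  Real.rpow_nonneg ENNReal.toReal_nonneg _

lemma ballRadius_lt_iff (hk : 1 ≤ k) {v : ℝ≥0∞} (hv : v ≠ ∞) {t : ℝ} (ht : 0 < t) :
    ballRadius k v < t ↔ v < volume (ball (0 : E k) t) := by
  have h0 : volume (ball (0 : E k) 1) ≠ 0 := (measure_ball_pos _ _ one_pos).ne'
  have hT : volume (ball (0 : E k) 1) ≠ ∞ := measure_ball_lt_top.ne
  rw [Measure.addHaar_ball_of_pos volume _ ht, finrank_euclideanSpace, Fintype.card_fin,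
    ← ENNReal.div_lt_iff (Or.inl h0) (Or.inl hT), ballRadius,
    Real.rpow_inv_lt_iff_of_pos ENNReal.toReal_nonneg ht.le (by positivity), Real.rpow_natCast,
    ENNReal.lt_ofReal_iff_toReal_lt (ENNReal.div_ne_top hv h0)]

variable (k m s) in
/-- The kernel that rearranges, on each slice, the kernel of the fractional Laplacian in the order
of increasing values of `g`. -/
noncomputable def sortedKernel (g : E k × E m → ℝ) (x : E (k + m)) : ℝ :=
  letI p := (joinEquiv k m).symm x
  letI v := rank volume (fun y => g (y, p.2)) p.1
  if v = ∞ then 0 else profile k m s (ballRadius k v) p.2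

lemma sortedKernel_join (g : E k × E m → ℝ) (y : E k) (z : E m) :
    sortedKernel k m s g (join y z) =
      if rank volume (fun y => g (y, z)) y = ∞ then 0
      else profile k m s (ballRadius k (rank volume (fun y => g (y, z)) y)) z := by
  rw [sortedKernel, show join y z = joinEquiv k m (y, z) from (joinEquiv_apply (y, z)).symm,
    MeasurableEquiv.symm_apply_apply]

lemma sortedKernel_nonneg (g : E k × E m → ℝ) (x : E (k + m)) : 0 ≤ sortedKernel k m s g x := by
  unfold sortedKernel
  split_ifs
  exacts [le_rfl, profile_nonneg _ _]

lemma measurable_sortedKernel {g : E k × E m → ℝ} (hg : Measurable g) :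
    Measurable (sortedKernel k m s g) := by
  have hr := measurable_rank hg (volume : Measure (E k))
  have h : Measurable fun p : E k × E m =>
      if rank volume (fun y => g (y, p.2)) p.1 = ∞ then 0
      else profile k m s (ballRadius k (rank volume (fun y => g (y, p.2)) p.1)) p.2 := by
    refine Measurable.ite (measurableSet_eq_fun hr measurable_const) measurable_const ?_
    unfold profile ballRadius
    fun_prop
  exact h.comp (joinEquiv k m).symm.measurable

lemma tsupport_sortedKernel_subset {g : E k × E m → ℝ} {c₀ : ℝ} (z : E m)
    (hg : Continuous fun y => g (y, z)) (hinf : volume {y | g (y, z) ≤ c₀} = ∞) :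
    tsupport (fun y => sortedKernel k m s g (join y z)) ⊆ {y | g (y, z) ≤ c₀} := by
  refine closure_minimal (fun y hy => ?_) (isClosed_le hg continuous_const)
  rw [Function.mem_support, sortedKernel_join] at hy
  exact le_of_rank_ne_top hinf fun h => hy (if_pos h)

variable {g : E k × E m → ℝ} {c₀ : ℝ}

/-- The superlevel sets of the sorted kernel on a slice are initial, and have the right measure. -/
lemma sortedKernel_superlevel (hk : 1 ≤ k) (hs : 0 < s) (hg : Measurable g) (hg0 : ∀ p, 0 ≤ g p)
    (hc₀ : 0 < c₀) (z : E m) (hfin : ∀ c, 0 < c → c < c₀ → volume {y | g (y, z) ≤ c} < ∞)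
    (hinf : volume {y | g (y, z) ≤ c₀} = ∞) {r : ℝ} (hr : 0 < r) :
    ∃ A : Set (E k), IsInitial (fun y => g (y, z)) A ∧ MeasurableSet A ∧
      volume A = (if ‖z‖ < r then volume (ball (0 : E k) (√(r ^ 2 - ‖z‖ ^ 2))) else 0) ∧
      {y | r ^ (-((k + m : ℕ) : ℝ) - 2 * s) < sortedKernel k m s g (join y z)}
        =ᵐ[volume] A := by
  have : NeZero k := ⟨by omega⟩
  have : Nonempty (Fin k) := ⟨0⟩
  set f : E k → ℝ := fun y => g (y, z) with hf
  have hset : ∀ t, 0 < t → {y | y ∈ {y | rank volume f y ≠ ∞} ∧ ballRadius k (rank volume f y) < t}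
      = {y | rank volume f y < volume (ball (0 : E k) t)} := fun t ht => by
    ext y
    simp only [mem_ofPred_eq]
    constructor
    · rintro ⟨h, h'⟩
      exact (ballRadius_lt_iff hk h ht).1 h'
    · intro h
      exact ⟨h.ne_top, (ballRadius_lt_iff hk h.ne_top ht).2 h⟩
  have hex : ∀ v : ℝ≥0∞, v ≠ ∞ → _ := fun v hv => exists_isInitial_rank_lt_ae_eq volume (f := f)
    (v := v) (by fun_prop) (fun y => hg0 _) hc₀ hfin hinf hv
  have hae := setOf_lt_profile_ae_eq hk hs z (S := {y | rank volume f y ≠ ∞})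
    (ρ := fun y => ballRadius k (rank volume f y))
    (K := fun y => sortedKernel k m s g (join y z)) (fun y => ballRadius_nonneg _)
    (fun y hy => by rw [sortedKernel_join, if_neg hy])
    (fun y hy => by rw [sortedKernel_join, if_pos (not_not.1 hy)])
    (fun t ht => by
      obtain ⟨A, -, -, hA, hA'⟩ := hex (volume (ball (0 : E k) t)) measure_ball_lt_top.ne
      rw [hset t ht, measure_congr hA', hA]) hr
  by_cases hz : ‖z‖ < r
  · rw [if_pos hz, hset _ (Real.sqrt_pos.2 (by nlinarith [norm_nonneg z]))] at hae
    rw [if_pos hz]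
    obtain ⟨A, hA, hAm, hAv, hA'⟩ := hex (volume (ball (0 : E k) (√(r ^ 2 - ‖z‖ ^ 2))))
      measure_ball_lt_top.ne
    exact ⟨A, hA, hAm, hAv, hae.trans hA'⟩
  · rw [if_neg hz] at hae
    rw [if_neg hz]
    exact ⟨∅, fun x hx => hx.elim, .empty, measure_empty, hae⟩

lemma sortedKernel_mem_kernels (hk : 1 ≤ k) (hs : 0 < s) (hg : Measurable g) (hg0 : ∀ p, 0 ≤ g p)
    (hc₀ : 0 < c₀) (hfin : ∀ z c, 0 < c → c < c₀ → volume {y | g (y, z) ≤ c} < ∞)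
    (hinf : ∀ z, volume {y | g (y, z) ≤ c₀} = ∞) : sortedKernel k m s g ∈ kernels k m s := by
  refine ⟨sortedKernel_nonneg g, (measurable_sortedKernel hg).aemeasurable, fun z => ?_,
    fun z r hr => ?_⟩
  · exact ((measurable_sortedKernel hg).comp
      (continuous_join.measurable.comp measurable_prodMk_right)).aemeasurable
  · obtain ⟨A, -, -, hA, hA'⟩ := sortedKernel_superlevel hk hs hg hg0 hc₀ z (hfin z) (hinf z) hr
    rw [measure_congr hA', hA]

/-- On every slice the sorted kernel minimizes the integral against `g`. -/
lemma lintegral_mul_sortedKernel_le (hk : 1 ≤ k) (hs : 0 < s) (hg : Measurable g)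
    (hg0 : ∀ p, 0 ≤ g p) (hc₀ : 0 < c₀)
    (hfin : ∀ z c, 0 < c → c < c₀ → volume {y | g (y, z) ≤ c} < ∞)
    (hinf : ∀ z, volume {y | g (y, z) ≤ c₀} = ∞) {K : E (k + m) → ℝ} (hK : K ∈ kernels k m s)
    (z : E m) :
    ∫⁻ y, ENNReal.ofReal (g (y, z) * sortedKernel k m s g (join y z)) ≤
      ∫⁻ y, ENNReal.ofReal (g (y, z) * K (join y z)) := by
  have hK₀ := sortedKernel_mem_kernels hk hs hg hg0 hc₀ hfin hinf
  have hf : Measurable fun y => g (y, z) := by fun_prop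
  rw [lintegral_mul_eq_lintegral_setLIntegral hf (fun _ => hg0 _) (hK₀.2.2.1 z)
      (fun _ => hK₀.1 _),
    lintegral_mul_eq_lintegral_setLIntegral hf (fun _ => hg0 _) (hK.2.2.1 z) (fun _ => hK.1 _)]
  refine setLIntegral_mono' measurableSet_Ioi fun t (ht : 0 < t) => ?_
  set b : ℝ := -((k + m : ℕ) : ℝ) - 2 * s with hb
  have hb0 : b ≠ 0 := by
    have : (0 : ℝ) ≤ ((k + m : ℕ) : ℝ) := Nat.cast_nonneg _
    rw [hb]
    linarith
  obtain ⟨r, hr, rfl⟩ : ∃ r : ℝ, 0 < r ∧ r ^ b = t :=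
    ⟨t ^ b⁻¹, Real.rpow_pos_of_pos ht _, Real.rpow_inv_rpow ht.le hb0⟩
  obtain ⟨A, hA, hAm, hAv, hA'⟩ :=
    sortedKernel_superlevel hk hs hg hg0 hc₀ z (hfin z) (hinf z) hr
  rw [setLIntegral_congr hA']
  have hKv := hK.2.2.2 z r hr
  refine hA.setLIntegral_le hAm.nullMeasurableSet
    (nullMeasurableSet_lt aemeasurable_const (hK.2.2.1 z)) (hAv.trans hKv.symm) ?_
  rw [hKv]
  split_ifs
  exacts [measure_ball_lt_top.ne, ENNReal.zero_ne_top]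

end Minimizer

lemma extIntegral_of_nonneg {n : ℕ} {f : E n → ℝ} (hf : ∀ x, 0 ≤ f x) :
    extIntegral f = ((∫⁻ x, ENNReal.ofReal (f x) : ℝ≥0∞) : EReal) := by
  simp [extIntegral, ENNReal.ofReal_of_nonpos (neg_nonpos.2 (hf _))]

end NonlocalMA

theorem theorem4p6 (k m : ℕ) (hk : 1 ≤ k) (hm : 1 ≤ m) (s : ℝ) (hs : 1 / 2 < s) (hs' : s < 1)
    (u : NonlocalMA.E (k + m) → ℝ) (x₀ : NonlocalMA.E (k + m))
    (hcont : Continuous u) (hC11 : NonlocalMA.C11At u x₀)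
    (hP1 : Integrable (fun x => |u x| / (1 + ‖x‖) ^ (((k + m : ℕ) : ℝ) + 2 * s)) volume)
    (hP2 : ∀ x, 0 ≤ NonlocalMA.tilde u x₀ x)
    (lam₀ : ℝ) (hlam₀ : 0 < lam₀)
    (hfin : ∀ (z : NonlocalMA.E m) (lam : ℝ), 0 < lam → lam < lam₀ →
      volume {y : NonlocalMA.E k | NonlocalMA.tilde u x₀ (NonlocalMA.join y z) ≤ lam} < ⊤)
    (hinf : ∀ (z : NonlocalMA.E m) (lam : ℝ), lam₀ ≤ lam →
      volume {y : NonlocalMA.E k | NonlocalMA.tilde u x₀ (NonlocalMA.join y z) ≤ lam} = ⊤) :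
    ∃ K₀ ∈ NonlocalMA.kernels k m s,
      (∀ z : NonlocalMA.E m, tsupport (fun y : NonlocalMA.E k => K₀ (NonlocalMA.join y z)) ⊆
        {y | NonlocalMA.tilde u x₀ (NonlocalMA.join y z) ≤ lam₀}) ∧
      Integrable (fun x => NonlocalMA.tilde u x₀ x * K₀ x) volume ∧
      NonlocalMA.nonlocalOp k m s u x₀ =
        ((NonlocalMA.fracConst (k + m) s * ∫ z : NonlocalMA.E m, ∫ y : NonlocalMA.E k,
          NonlocalMA.tilde u x₀ (NonlocalMA.join y z) * K₀ (NonlocalMA.join y z) : ℝ) : EReal) ∧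
      IsMinOn (fun K => NonlocalMA.extIntegral (fun x => NonlocalMA.tilde u x₀ x * K x))
        (NonlocalMA.kernels k m s) K₀ := by
  open NonlocalMA in
  have hs0 : 0 < s := by linarith
  have htc : Continuous (tilde u x₀) := by
    unfold tilde
    fun_prop
  set g : E k × E m → ℝ := fun p => tilde u x₀ (join p.1 p.2) with hgdef
  have hgc : Continuous g := htc.comp continuous_join
  have hg : Measurable g := hgc.measurable
  have hg0 : ∀ p, 0 ≤ g p := fun p => hP2 _
  have hinf' : ∀ z : E m, volume {y | g (y, z) ≤ lam₀} = ∞ := fun z => hinf z lam₀ le_rfl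
  have hK₀ : sortedKernel k m s g ∈ kernels k m s :=
    sortedKernel_mem_kernels hk hs0 hg hg0 hlam₀ hfin hinf'
  have haem : ∀ K ∈ kernels k m s, AEMeasurable fun x => tilde u x₀ x * K x :=
    fun K hK => htc.measurable.aemeasurable.mul hK.2.1
  have hext : ∀ K ∈ kernels k m s, extIntegral (fun x => tilde u x₀ x * K x) =
      ((∫⁻ x, ENNReal.ofReal (tilde u x₀ x * K x) : ℝ≥0∞) : EReal) :=
    fun K hK => extIntegral_of_nonneg fun x => mul_nonneg (hP2 x) (hK.1 x)
  have hle : ∀ K ∈ kernels k m s,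
      ∫⁻ x, ENNReal.ofReal (tilde u x₀ x * sortedKernel k m s g x) ≤
        ∫⁻ x, ENNReal.ofReal (tilde u x₀ x * K x) := fun K hK => by
    rw [lintegral_join (haem _ hK₀).ennreal_ofReal, lintegral_join (haem K hK).ennreal_ofReal]
    exact lintegral_mono fun z =>
      lintegral_mul_sortedKernel_le hk hs0 hg hg0 hlam₀ hfin hinf' hK z
  have hmin : IsMinOn (fun K => extIntegral (fun x => tilde u x₀ x * K x)) (kernels k m s)
      (sortedKernel k m s g) := fun K hK => by
    show extIntegral _ ≤ extIntegral _
    rw [hext _ hK₀, hext K hK]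
    exact_mod_cast hle K hK
  have hint : Integrable fun x => tilde u x₀ x * sortedKernel k m s g x := by
    refine ⟨(haem _ hK₀).aestronglyMeasurable, ?_⟩
    rw [hasFiniteIntegral_iff_ofReal (.of_forall fun x => mul_nonneg (hP2 x) (hK₀.1 x))]
    refine (hle _ (norm_rpow_mem_kernels hk hs0)).trans_lt ?_
    exact (integrable_tilde_mul_norm_rpow (by omega) hs hs' hcont hC11 hP1).lintegral_lt_top
  refine ⟨_, hK₀, fun z => tsupport_sortedKernel_subset z (by fun_prop) (hinf' z), hint, ?_, hmin⟩
  have hinfeq : ⨅ K ∈ kernels k m s, extIntegral (fun x => tilde u x₀ x * K x) =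
      extIntegral (fun x => tilde u x₀ x * sortedKernel k m s g x) :=
    le_antisymm (iInf₂_le _ hK₀) (le_iInf₂ fun K hK => hmin hK)
  rw [nonlocalOp, hinfeq, hext _ hK₀, ← integral_join hint, EReal.coe_mul,
    ← ofReal_integral_eq_lintegral_ofReal hint
      (.of_forall fun x => mul_nonneg (hP2 x) (hK₀.1 x)), EReal.coe_ennreal_ofReal,
    max_eq_left (integral_nonneg fun x => mul_nonneg (hP2 x) (hK₀.1 x))]
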